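/- A (rational polyhedral) fan in $\mathbb{R}^n$ is a finite nonempty collection $\mathcal{F}$ of convex cones, each generated by finitely many vectors of $\mathbb{Z}^n$ (cones may contain lines), that is closed under taking faces and in which any two cones intersect in a common face. Its dimension $\dim\mathcal{F}$ is the maximal dimension of a cone of $\mathcal{F}$, and $\operatorname{codim}\mathcal{F}=n-\dim\mathcal{F}$. The cones of dimension $\dim\mathcal{F}$ are its facets, those of dimension $\dim\mathcal{F}-1$ its ridges. Given real weights $w(\sigma)$ on the facets $\sigma$ of $\mathcal{F}$, the weighted fan is balanced if for every ridge $\tau$ $$\sum_{\sigma\supset\tau} w(\sigma)\,v_{\sigma/\tau}\in\operatorname{span}(\tau),$$ where the sum is over the facets $\sigma$ containing $\tau$, and $v_{\sigma/\tau}\in\sigma\cap\mathbb{Z}^n$ is a vector whose class generates $(\mathbb{Z}^n\cap\operatorname{span}\sigma)/(\mathbb{Z}^n\cap\operatorname{span}\tau)$. Let $\mathcal{F}_1,\dots,\mathcal{F}_k$ be balanced fans in $\mathbb{R}^n$ with positive weights. Then $$\operatorname{codim}(\mathcal{F}_1\cap\cdots\cap\mathcal{F}_k)\le \operatorname{codim}(\mathcal{F}_1)+\cdots+\operatorname{codim}(\mathcal{F}_k),$$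 where $\mathcal{F}_1\cap\cdots\cap\mathcal{F}_k$ is the intersection of the supports, which is the union of the cones $C_1\cap\cdots\cap C_k$ with $C_i\in\mathcal{F}_i$, and its codimension is $n$ minus the maximal dimension of these cones. -/

import Mathlib

/-- Convex cones in `ℝⁿ` that contain the origin (lineality spaces are allowed). -/
abbrev RealCone (n : ℕ) := PointedCone ℝ (Fin n → ℝ)

/-- The lattice point of `ℝⁿ` with the given integer coordinates. -/
def latticePoint {n : ℕ} (v : Fin n → ℤ) : Fin n → ℝ := fun j => (v j : ℝ)

namespace RealCone

/-- The linear span of a cone. -/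
def linearSpan {n : ℕ} (C : RealCone n) : Submodule ℝ (Fin n → ℝ) :=
  Submodule.span ℝ (C : Set (Fin n → ℝ))

/-- The dimension of a cone: the dimension of its linear span. -/
noncomputable def dim {n : ℕ} (C : RealCone n) : ℕ :=
  Module.finrank ℝ C.linearSpan

/-- A rational polyhedral cone: generated by finitely many lattice vectors. -/
def IsRational {n : ℕ} (C : RealCone n) : Prop :=
  ∃ s : Finset (Fin n → ℤ), C = PointedCone.hull ℝ (latticePoint '' (s : Set (Fin n → ℤ)))

theorem dim_le {n : ℕ} (C : RealCone n) : C.dim ≤ n := by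
  simpa [dim] using Submodule.finrank_le C.linearSpan

end RealCone

/-- The dimension of a collection of cones: the maximum of the dimensions of its members. -/
noncomputable def conesDim {n : ℕ} (S : Set (RealCone n)) : ℕ := sSup (RealCone.dim '' S)

/-- The codimension in `ℝⁿ` of a collection of cones. -/
noncomputable def conesCodim {n : ℕ} (S : Set (RealCone n)) : ℤ := (n : ℤ) - (conesDim S : ℤ)

/-- A rational polyhedral fan in `ℝⁿ`: a finite nonempty collection of rational polyhedral cones,
closed under taking faces, in which any two cones meet in a common face. It need be neither
complete nor pure, and its cones may contain lines. -/
structure RationalFan (n : ℕ) where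
  /-- The cones of the fan. -/
  cones : Finset (RealCone n)
  nonempty : cones.Nonempty
  isRational : ∀ C ∈ cones, RealCone.IsRational C
  face_mem : ∀ C ∈ cones, ∀ D : RealCone n, D.IsFaceOf C → D ∈ cones
  inter_face : ∀ C ∈ cones, ∀ D ∈ cones, (C ⊓ D).IsFaceOf C ∧ (C ⊓ D).IsFaceOf D

/-- `v` is a lattice normal vector of the cone `σ` relative to its facet `τ`: a lattice vector of
`σ` whose class generates the quotient of lattices `(ℤⁿ ∩ span σ) / (ℤⁿ ∩ span τ)`. For `τ` of
codimension one in `σ` this class is unique. -/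
def IsLatticeNormal {n : ℕ} (τ σ : RealCone n) (v : Fin n → ℤ) : Prop :=
  latticePoint v ∈ σ ∧
    ∀ u : Fin n → ℤ, latticePoint u ∈ σ.linearSpan →
      ∃ m : ℤ, latticePoint (u - m • v) ∈ τ.linearSpan

namespace RationalFan

/-- The support of a fan: the union of its cones. -/
def support {n : ℕ} (F : RationalFan n) : Set (Fin n → ℝ) :=
  ⋃ C ∈ F.cones, (C : Set (Fin n → ℝ))

/-- The dimension of a fan. -/
noncomputable def dim {n : ℕ} (F : RationalFan n) : ℕ := conesDim (F.cones : Set (RealCone n))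

/-- The codimension of a fan in `ℝⁿ`. -/
noncomputable def codim {n : ℕ} (F : RationalFan n) : ℤ := conesCodim (F.cones : Set (RealCone n))

open Classical in
/-- The facets of a fan: its cones of maximal dimension. -/
noncomputable def facets {n : ℕ} (F : RationalFan n) : Finset (RealCone n) :=
  F.cones.filter fun σ => σ.dim = F.dim

open Classical in
/-- The fan `F` with weight `w σ` on each facet `σ` is balanced: at every ridge `τ` (cone of
dimension `dim F - 1`) the weighted sum of the lattice normal vectors of the facets that contain
`τ` lies in the span of `τ`. The choice of the normal vectors does not matter, as they are unique
modulo the span of `τ`. -/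
def IsBalanced {n : ℕ} (F : RationalFan n) (w : RealCone n → ℝ) : Prop :=
  ∀ τ ∈ F.cones, τ.dim + 1 = F.dim →
    ∃ v : RealCone n → (Fin n → ℤ),
      (∀ σ ∈ F.facets, τ ≤ σ → IsLatticeNormal τ σ (v σ)) ∧
      ∑ σ ∈ F.facets.filter (fun σ => τ ≤ σ), w σ • latticePoint (v σ) ∈ τ.linearSpan

/-- The intersection of finitely many fans, as a collection of cones (the common refinement):
all intersections of one cone from each fan. For the empty family this is `{ℝⁿ}`. -/
def inter {n k : ℕ} (F : Fin k → RationalFan n) : Set (RealCone n) :=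
  {D | ∃ C : Fin k → RealCone n, (∀ i, C i ∈ (F i).cones) ∧ D = ⨅ i, C i}

/-- The cones of the intersection cover exactly the intersection of the supports. -/
theorem iUnion_inter {n k : ℕ} (F : Fin k → RationalFan n) :
    (⋃ D ∈ inter F, (D : Set (Fin n → ℝ))) = ⋂ i, (F i).support := by
  ext x
  simp only [inter, support, Set.mem_iUnion, Set.mem_iInter, Set.mem_ofPred_eq, SetLike.mem_coe,
    exists_prop]
  constructor
  · rintro ⟨D, ⟨C, hC, rfl⟩, hx⟩ i
    exact ⟨C i, hC i, (Submodule.mem_iInf _).1 hx i⟩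
  · intro h
    choose C hC hx using h
    exact ⟨_, ⟨C, hC, rfl⟩, (Submodule.mem_iInf _).2 hx⟩

end RationalFan

/-!
Positive balancing is a maximum principle. Suppose that a subspace `K` meets the span of every
facet nontrivially, but every facet only in `0`. Then the fibres `|𝓕| ∩ (x + K)` are compact. Shrink
`K` to a minimal subspace meeting all the spans; minimality makes `K ∩ span σ₀` a line for some
facet `σ₀`, so a generic `x ∈ σ₀` has a fibre that avoids all faces of codimension at least two.
A generic linear functional is not constant along `K ∩ span σ` for any facet `σ`, so it attains its
maximum on this fibre inside a ridge, where balancing provides a facet along which it increases: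
a contradiction. Hence a subspace that meets every facet only in `0` has dimension at most the
codimension of the fan.

For several fans, apply this to the product of the fans and to the diagonal copy of a subspace `K`
that is a complement of the span of one cone `C₁ ∩ ⋯ ∩ Cₖ` and meets the spans of all the others
only in `0`.
-/

open Module Set Metric

section Submodules

variable {ι 𝕜 V : Type*} [Field 𝕜] [AddCommGroup V] [Module 𝕜 V]

theorem exists_le_forall_not_disjoint_isAtom {α : Type*} [Lattice α] [OrderBot α]
    [IsModularLattice α] [WellFoundedLT α] [IsStronglyCoatomic α] {s : Set ι} (hs : s.Nonempty)
    (W : ι → α) (K : α) (hK : ∀ i ∈ s, ¬ Disjoint K (W i)) :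
    ∃ K' ≤ K, (∀ i ∈ s, ¬ Disjoint K' (W i)) ∧ ∃ i ∈ s, IsAtom (K' ⊓ W i) := by
  obtain ⟨K', hK'K, hK', hmin⟩ :=
    exists_minimal_le_of_wellFoundedLT (fun L => ∀ i ∈ s, ¬ Disjoint L (W i)) K hK
  obtain ⟨i₀, hi₀⟩ := hs
  have hbot : ⊥ < K' :=
    bot_lt_iff_ne_bot.2 fun h => hK' i₀ hi₀ (h ▸ disjoint_bot_left)
  obtain ⟨H, -, hH⟩ := exists_le_covBy_of_lt hbot
  obtain ⟨i, his, hi⟩ : ∃ i ∈ s, Disjoint H (W i) := by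
    by_contra! h
    exact hH.lt.not_ge (hmin h hH.le)
  have hHi : H ⊓ (K' ⊓ W i) = ⊥ := by
    rw [← inf_assoc, inf_eq_left.2 hH.le, hi.eq_bot]
  have hsup : H ⊔ K' ⊓ W i = K' := by
    refine (hH.eq_or_eq le_sup_left (sup_le hH.le inf_le_left)).resolve_left fun h => hK' i his ?_
    have hle : K' ⊓ W i ≤ H := h ▸ le_sup_right
    rw [disjoint_iff, ← hHi, inf_eq_right.2 hle]
  refine ⟨K', hK'K, hK', i, his, bot_covBy_iff.1 ?_⟩
  rw [← hHi]
  exact inf_covBy_of_covBy_sup_left (hsup.symm ▸ hH)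

theorem exists_disjoint_isCompl [FiniteDimensional 𝕜 V] [Infinite 𝕜] {s : Set ι} (hs : s.Finite)
    (hs' : s.Nonempty) (W : ι → Submodule 𝕜 V) :
    ∃ K : Submodule 𝕜 V, (∀ i ∈ s, Disjoint K (W i)) ∧ ∃ i ∈ s, IsCompl K (W i) := by
  obtain ⟨K, -, hK, hmax⟩ := exists_maximal_ge_of_wellFoundedGT
    (fun L : Submodule 𝕜 V => ∀ i ∈ s, Disjoint L (W i)) ⊥ fun _ _ => disjoint_bot_left
  refine ⟨K, hK, ?_⟩
  by_contra! h
  have := hs.to_subtype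
  obtain ⟨v, hv⟩ := Submodule.exists_forall_notMem_of_forall_ne_top (fun i : s => K ⊔ W i)
    fun i hi => h i i.2 ⟨hK i i.2, codisjoint_iff.2 hi⟩
  have hle : 𝕜 ∙ v ⊔ K ≤ K := hmax (fun i hi => (hK i hi).disjoint_sup_left_of_disjoint_sup_right
    (Submodule.disjoint_span_singleton_of_notMem (hv ⟨i, hi⟩)).symm) le_sup_right
  exact hv ⟨_, hs'.some_mem⟩ (Submodule.mem_sup_left (hle (Submodule.mem_sup_left
    (Submodule.mem_span_singleton_self v))))

theorem sup_inf_eq_of_finrank_add_one_eq [FiniteDimensional 𝕜 V] {A B K : Submodule 𝕜 V}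
    (hAB : A ≤ B) (hdim : finrank 𝕜 A + 1 = finrank 𝕜 B) (hA : Disjoint K A)
    (hB : ¬ Disjoint K B) : A ⊔ K ⊓ B = B := by
  refine Submodule.eq_of_le_of_finrank_le (sup_le hAB inf_le_right) ?_
  have hsum := Submodule.finrank_sup_add_finrank_inf_eq A (K ⊓ B)
  have hinf : A ⊓ (K ⊓ B) = ⊥ := (hA.symm.mono_right inf_le_left).eq_bot
  have hpos : 1 ≤ finrank 𝕜 (K ⊓ B : Submodule 𝕜 V) :=
    Submodule.one_le_finrank_iff.2 (disjoint_iff.not.1 hB)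
  rw [hinf, finrank_bot] at hsum
  omega

theorem exists_dual_forall_exists_mem_ne_zero [Infinite 𝕜] {s : Set ι} (hs : s.Finite)
    {W : ι → Submodule 𝕜 V} (hW : ∀ i ∈ s, W i ≠ ⊥) :
    ∃ ℓ : Dual 𝕜 V, ∀ i ∈ s, ∃ u ∈ W i, ℓ u ≠ 0 := by
  have := hs.to_subtype
  choose u hu hu0 using fun i : s => Submodule.exists_mem_ne_zero_of_ne_bot (hW i i.2)
  obtain ⟨ℓ, hℓ⟩ := Module.exists_dual_forall_apply_ne_zero (K := 𝕜) u hu0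
  exact ⟨ℓ, fun i hi => ⟨u ⟨i, hi⟩, hu ⟨i, hi⟩, hℓ ⟨i, hi⟩⟩⟩

end Submodules

section Cones

variable {ι 𝕜 V : Type*} [Field 𝕜] [LinearOrder 𝕜] [IsStrictOrderedRing 𝕜] [AddCommGroup V]
  [Module 𝕜 V]

theorem exists_mem_forall_notMem {s : Set ι} (hs : s.Finite) (C : PointedCone 𝕜 V)
    (W : ι → Submodule 𝕜 V) (hW : ∀ i ∈ s, ∃ x ∈ C, x ∉ W i) : ∃ x ∈ C, ∀ i ∈ s, x ∉ W i := by
  induction s, hs using Set.Finite.induction_on with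
  | empty => exact ⟨0, C.zero_mem, by simp⟩
  | @insert j s _ hs ih =>
    obtain ⟨x, hxC, hx⟩ := ih fun i hi => hW i (mem_insert_of_mem j hi)
    obtain ⟨y, hyC, hy⟩ := hW j (mem_insert j s)
    have hsub : ∀ i ∈ insert j s, {t : 𝕜 | x + t • y ∈ W i}.Subsingleton := by
      intro i hi t ht t' ht'
      by_contra hne
      have hyi : y ∈ W i := by
        refine ((W i).smul_mem_iff (sub_ne_zero.2 hne)).1 ?_
        convert (W i).sub_mem ht ht' using 1
        module
      have hxi : x ∈ W i := ((W i).add_mem_iff_left ((W i).smul_mem t hyi)).1 ht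
      rcases hi with rfl | his
      exacts [hy hyi, hx i his hxi]
    obtain ⟨t, ht, htW⟩ := (Ioi_infinite (0 : 𝕜)).exists_notMem_finite
      ((hs.insert j).biUnion fun i hi => (hsub i hi).finite)
    simp only [mem_iUnion, mem_ofPred_eq, not_exists] at htW
    exact ⟨x + t • y, C.add_mem hxC (C.smul_mem (le_of_lt ht) hyC), htW⟩

theorem hull_inter_eq_of_isFaceOf {s : Finset V} {τ : PointedCone 𝕜 V}
    (hτ : τ.IsFaceOf (PointedCone.hull 𝕜 s)) : PointedCone.hull 𝕜 (s ∩ τ : Set V) = τ := by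
  refine le_antisymm (Submodule.span_le.2 inter_subset_right) fun x hx => ?_
  obtain ⟨f, -, rfl⟩ := Submodule.mem_span_finset.1 (hτ.le hx)
  refine Submodule.sum_mem _ fun e he => ?_
  rcases (f e).2.eq_or_lt with h0 | hpos
  · have : f e = 0 := (Subtype.ext h0).symm
    simp [this]
  · refine Submodule.smul_mem _ _ (PointedCone.subset_hull ⟨he, ?_⟩)
    rw [← Finset.sum_coe_sort] at hx
    exact hτ.mem_of_sum_smul_mem (ι := s) (f := fun e => (e : V)) (c := fun e => (f e : 𝕜))
      (fun e => PointedCone.subset_hull e.2) (fun e => (f e).2) hx ⟨e, he⟩ hpos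

theorem finite_setOf_isFaceOf {C : PointedCone 𝕜 V} (hC : C.FG) :
    {τ : PointedCone 𝕜 V | τ.IsFaceOf C}.Finite := by
  obtain ⟨s, rfl⟩ := hC
  refine (s.finite_toSet.finite_subsets.image (PointedCone.hull 𝕜)).subset fun τ hτ => ?_
  exact ⟨s ∩ τ, inter_subset_left, hull_inter_eq_of_isFaceOf hτ⟩

/-- `tangentLineality C z`, the lineality space of the tangent cone of `C` at `z`: the vectors
that can be both added to and subtracted from a multiple of `z` without leaving `C`. For `z ∈ C`
it is the span of the smallest face of `C` that contains `z`. -/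
def tangentLineality (C : PointedCone 𝕜 V) (z : V) : Submodule 𝕜 V where
  carrier := {u | ∃ r : 𝕜, 0 ≤ r ∧ r • z + u ∈ C ∧ r • z - u ∈ C}
  zero_mem' := ⟨0, le_rfl, by simp, by simp⟩
  add_mem' := by
    rintro u v ⟨r, hr, hru, hru'⟩ ⟨s, hs, hsv, hsv'⟩
    refine ⟨r + s, add_nonneg hr hs, ?_, ?_⟩
    · convert C.add_mem hru hsv using 1
      module
    · convert C.add_mem hru' hsv' using 1
      module
  smul_mem' := by
    rintro c u ⟨r, hr, hru, hru'⟩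
    rcases le_total 0 c with hc | hc
    · refine ⟨c * r, mul_nonneg hc hr, ?_, ?_⟩
      · convert C.smul_mem hc hru using 1
        module
      · convert C.smul_mem hc hru' using 1
        module
    · refine ⟨-c * r, mul_nonneg (neg_nonneg.2 hc) hr, ?_, ?_⟩
      · convert C.smul_mem (neg_nonneg.2 hc) hru' using 1
        module
      · convert C.smul_mem (neg_nonneg.2 hc) hru using 1
        module

variable {C : PointedCone 𝕜 V} {u z : V}

theorem self_mem_tangentLineality (hz : z ∈ C) : z ∈ tangentLineality C z :=
  ⟨1, zero_le_one, by simpa using C.add_mem hz hz, by simp⟩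

theorem exists_pos_add_smul_mem (hz : z ∈ C) (hu : u ∈ tangentLineality C z) :
    ∃ ε : 𝕜, 0 < ε ∧ z + ε • u ∈ C := by
  obtain ⟨r, hr, hru, -⟩ := hu
  have hr1 : 0 < r + 1 := by positivity
  refine ⟨(r + 1)⁻¹, inv_pos.2 hr1, ?_⟩
  convert C.smul_mem (inv_pos.2 hr1).le (C.add_mem hru hz) using 1
  match_scalars <;> field_simp

theorem isFaceOf_inf_tangentLineality (hz : z ∈ C) :
    (C ⊓ PointedCone.ofSubmodule (tangentLineality C z)).IsFaceOf C where
  le := inf_le_left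
  mem_of_smul_add_mem := by
    rintro x y a hx hy ha ⟨-, r, hr, -, hsub⟩
    have hra : 0 ≤ a⁻¹ * r := by positivity
    refine ⟨hx, a⁻¹ * r, hra, C.add_mem (C.smul_mem hra hz) hx, ?_⟩
    convert C.smul_mem (inv_pos.2 ha).le (C.add_mem hsub hy) using 1
    match_scalars <;> simp [ha.ne']

theorem span_inf_tangentLineality_le (C : PointedCone 𝕜 V) (z : V) :
    Submodule.span 𝕜 (C ⊓ PointedCone.ofSubmodule (tangentLineality C z) : PointedCone 𝕜 V) ≤
      tangentLineality C z :=
  Submodule.span_le.2 fun _ hx => hx.2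

theorem apply_eq_zero_of_mem_tangentLineality {K : Submodule 𝕜 V} (hz : z ∈ C) {ℓ : Dual 𝕜 V}
    (hmax : ∀ y ∈ C, y - z ∈ K → ℓ y ≤ ℓ z) (hu : u ∈ tangentLineality C z) (huK : u ∈ K) :
    ℓ u = 0 := by
  have hle : ∀ v ∈ tangentLineality C z, v ∈ K → ℓ v ≤ 0 := by
    intro v hv hvK
    obtain ⟨ε, hε, hmem⟩ := exists_pos_add_smul_mem hz hv
    have h := hmax _ hmem (by simpa using K.smul_mem ε hvK)
    rw [map_add, map_smul, smul_eq_mul, add_le_iff_nonpos_right] at h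
    exact nonpos_of_mul_nonpos_right h hε
  refine le_antisymm (hle u hu huK) ?_
  simpa using hle (-u) (neg_mem hu) (neg_mem huK)

end Cones

section Caratheodory

variable {𝕜 V : Type*} [Field 𝕜] [LinearOrder 𝕜] [IsStrictOrderedRing 𝕜] [AddCommGroup V]
  [Module 𝕜 V]

theorem exists_sum_smul_eq_zero_of_not_linearIndepOn {s : Finset V}
    (hs : ¬ LinearIndepOn 𝕜 id (s : Set V)) :
    ∃ g : V → 𝕜, ∑ e ∈ s, g e • e = 0 ∧ ∃ e ∈ s, 0 < g e := by
  rw [linearIndepOn_finset_iff] at hs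
  push Not at hs
  obtain ⟨g, hg, e, he, hne⟩ := hs
  rcases lt_or_gt_of_ne hne with h | h
  · exact ⟨-g, by simpa using hg, e, he, by simpa using h⟩
  · exact ⟨g, hg, e, he, h⟩

theorem hull_eq_iUnion_hull_erase [DecidableEq V] {s : Finset V}
    (hs : ¬ LinearIndepOn 𝕜 id (s : Set V)) :
    (PointedCone.hull 𝕜 (s : Set V) : Set V) =
      ⋃ a ∈ s, ↑(PointedCone.hull 𝕜 ((s.erase a : Finset V) : Set V)) := by
  refine Subset.antisymm (fun x hx => ?_)
    (iUnion₂_subset fun a _ => Submodule.span_mono (mod_cast s.erase_subset a))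
  obtain ⟨f, -, rfl⟩ := Submodule.mem_span_finset.1 hx
  obtain ⟨g, hg, e₀, he₀⟩ := exists_sum_smul_eq_zero_of_not_linearIndepOn hs
  -- Subtract the largest multiple of the relation `g` that keeps all coefficients nonnegative.
  obtain ⟨a, ha, hmin⟩ := (s.filter fun e => 0 < g e).exists_min_image
    (fun e => (f e : 𝕜) / g e) ⟨e₀, Finset.mem_filter.2 he₀⟩
  obtain ⟨has, hga⟩ := Finset.mem_filter.1 ha
  have hcoeff : ∀ e ∈ s, 0 ≤ (f e : 𝕜) - f a / g a * g e := by
    intro e he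
    rcases lt_or_ge 0 (g e) with h | h
    · exact sub_nonneg.2 ((le_div_iff₀ h).1 (hmin e (Finset.mem_filter.2 ⟨he, h⟩)))
    · exact sub_nonneg.2 ((mul_nonpos_of_nonneg_of_nonpos (div_nonneg (f a).2 hga.le) h).trans
        (f e).2)
  have hsum : ∑ e ∈ s, f e • e = ∑ e ∈ s.erase a, ((f e : 𝕜) - f a / g a * g e) • e := by
    rw [Finset.sum_erase s (by rw [div_mul_cancel₀ _ hga.ne', sub_self, zero_smul])]
    simp only [sub_smul, Finset.sum_sub_distrib, mul_smul, ← Finset.smul_sum, hg, smul_zero,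
      sub_zero]
    rfl
  rw [hsum]
  exact mem_iUnion₂.2 ⟨a, has, Submodule.sum_mem _ fun e he => PointedCone.smul_mem _
    (hcoeff e (Finset.mem_of_mem_erase he)) (PointedCone.subset_hull (mod_cast he))⟩

end Caratheodory

section Topology

theorem isClosed_of_fg {E : Type*} [AddCommGroup E] [Module ℝ E] [TopologicalSpace E]
    [IsTopologicalAddGroup E] [ContinuousSMul ℝ E] [T2Space E] {C : PointedCone ℝ E}
    (hC : C.FG) : IsClosed (C : Set E) := by
  classical
  obtain ⟨s, rfl⟩ := hC
  induction s using Finset.strongInduction with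
  | H s ih =>
  by_cases hs : LinearIndepOn ℝ id (s : Set E)
  · have hclosed := (LinearMap.isClosedEmbedding_of_injective (LinearMap.ker_eq_bot.2
      (linearIndependent_iff_injective_fintypeLinearCombination.1 hs))).isClosedMap
      (Ici 0) isClosed_Ici
    convert hclosed using 1
    ext x
    simp only [SetLike.mem_coe, mem_image, mem_Ici, Fintype.linearCombination_apply]
    constructor
    · intro hx
      obtain ⟨f, -, rfl⟩ := Submodule.mem_span_finset.1 hx
      exact ⟨fun e => f e, fun e => (f e).2, Finset.sum_coe_sort s fun e => (f e : ℝ) • e⟩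
    · rintro ⟨f, hf, rfl⟩
      exact Submodule.sum_mem _ fun e _ =>
        PointedCone.smul_mem _ (hf e) (PointedCone.subset_hull e.2)
  · rw [hull_eq_iUnion_hull_erase hs]
    exact s.finite_toSet.isClosed_biUnion fun a ha => ih _ (Finset.erase_ssubset ha)

variable {E : Type*} [NormedAddCommGroup E] [NormedSpace ℝ E] [FiniteDimensional ℝ E]

theorem isCompact_inter_preimage_sub {C : PointedCone ℝ E} (hC : IsClosed (C : Set E))
    {K : Submodule ℝ E} (hCK : ∀ x ∈ C, x ∈ K → x = 0) (x : E) :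
    IsCompact {y | y ∈ C ∧ y - x ∈ K} := by
  have hK : IsClosed (K : Set E) := K.closed_of_finiteDimensional
  have hdisj : Disjoint (sphere 0 1 ∩ C : Set E) K := by
    refine Set.disjoint_left.2 fun y hy hyK => ?_
    simpa [hCK y hy.2 hyK] using hy.1
  -- Unit vectors of `C` have distance at least `r` from `K`, so `r * ‖y‖ ≤ ‖y - (y - x)‖ = ‖x‖`.
  obtain ⟨r, hr, hlt⟩ := exists_pos_forall_lt_edist ((isCompact_sphere 0 1).inter_right hC) hK hdisj
  refine isCompact_of_isClosed_isBounded
    (hC.inter (hK.preimage (continuous_sub_right x)))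
    (isBounded_iff_forall_norm_le.2 ⟨‖x‖ / r, fun y ⟨hyC, hyK⟩ => ?_⟩)
  rcases eq_or_ne y 0 with rfl | hy
  · simp only [norm_zero]; positivity
  have hy' : 0 < ‖y‖ := norm_pos_iff.2 hy
  have hdist := hlt (‖y‖⁻¹ • y) ⟨by simp [norm_smul, hy], C.smul_mem (by positivity) hyC⟩
    (‖y‖⁻¹ • (y - x)) (K.smul_mem _ hyK)
  rw [edist_nndist, ENNReal.coe_lt_coe, ← NNReal.coe_lt_coe, coe_nndist, dist_eq_norm, ← smul_sub,
    sub_sub_cancel, norm_smul, norm_inv, norm_norm, inv_mul_eq_div, lt_div_iff₀ hy'] at hdist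
  rw [le_div_iff₀ (NNReal.coe_pos.2 hr), mul_comm]
  exact hdist.le

theorem exists_mem_sub_mem_forall_le {𝓢 : Set (PointedCone ℝ E)} (hfin : 𝓢.Finite)
    (hclosed : ∀ σ ∈ 𝓢, IsClosed (σ : Set E)) {K : Submodule ℝ E}
    (hK : ∀ σ ∈ 𝓢, ∀ x ∈ σ, x ∈ K → x = 0) {σ₀ : PointedCone ℝ E} (hσ₀ : σ₀ ∈ 𝓢) {x : E}
    (hx : x ∈ σ₀) (ℓ : Dual ℝ E) :
    ∃ σ ∈ 𝓢, ∃ z ∈ σ, z - x ∈ K ∧ ∀ ρ ∈ 𝓢, ∀ y ∈ ρ, y - z ∈ K → ℓ y ≤ ℓ z := by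
  have hcompact : IsCompact (⋃ σ ∈ 𝓢, {y | y ∈ σ ∧ y - x ∈ K}) :=
    hfin.isCompact_biUnion fun σ hσ => isCompact_inter_preimage_sub (hclosed σ hσ) (hK σ hσ) x
  obtain ⟨z, hz, hmax⟩ := hcompact.exists_isMaxOn
    ⟨x, mem_biUnion hσ₀ ⟨hx, by simp⟩⟩ ℓ.continuous_of_finiteDimensional.continuousOn
  obtain ⟨σ, hσ, hzσ, hzx⟩ := mem_iUnion₂.1 hz
  refine ⟨σ, hσ, z, hzσ, hzx, fun ρ hρ y hy hyz => hmax (mem_biUnion hρ ⟨hy, ?_⟩)⟩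
  simpa using K.add_mem hyz hzx

end Topology

/-- `IsLocallyBalanceable 𝓢 d`: a finite nonempty family `𝓢` of finitely generated cones with
`d`-dimensional spans satisfies a balancing condition at each `(d - 1)`-dimensional face `τ` of a
member: no linear functional that vanishes on `τ` is nonpositive, but not identically zero, on the
union of the members that contain `τ`. By linear programming duality this says that, modulo the
span of `τ`, positive multiples of vectors normal to `τ` in these members sum to zero; unlike the
weights, which may depend on `τ`, the condition passes to products without any computation. -/
structure IsLocallyBalanceable {𝕜 V : Type*} [Field 𝕜] [LinearOrder 𝕜] [IsStrictOrderedRing 𝕜]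
    [AddCommGroup V] [Module 𝕜 V] (𝓢 : Set (PointedCone 𝕜 V)) (d : ℕ) : Prop where
  finite : 𝓢.Finite
  nonempty : 𝓢.Nonempty
  fg : ∀ σ ∈ 𝓢, σ.FG
  finrank_span : ∀ σ ∈ 𝓢, finrank 𝕜 (Submodule.span 𝕜 (σ : Set V)) = d
  exists_pos : ∀ σ ∈ 𝓢, ∀ τ : PointedCone 𝕜 V, τ.IsFaceOf σ →
    finrank 𝕜 (Submodule.span 𝕜 (τ : Set V)) + 1 = d →
    ∀ g : Dual 𝕜 V, (∀ x ∈ τ, g x = 0) → (∃ x ∈ σ, g x ≠ 0) →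
    ∃ ρ ∈ 𝓢, τ ≤ ρ ∧ ∃ y ∈ ρ, 0 < g y

namespace IsLocallyBalanceable

section Ridges

variable {𝕜 V : Type*} [Field 𝕜] [LinearOrder 𝕜] [IsStrictOrderedRing 𝕜] [AddCommGroup V]
  [Module 𝕜 V] {𝓢 : Set (PointedCone 𝕜 V)} {d : ℕ} {K : Submodule 𝕜 V}

theorem finite_faces (h : IsLocallyBalanceable 𝓢 d) :
    {τ : PointedCone 𝕜 V | ∃ σ ∈ 𝓢, τ.IsFaceOf σ}.Finite :=
  (h.finite.biUnion fun σ hσ => finite_setOf_isFaceOf (h.fg σ hσ)).subset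
    fun _ ⟨_, hσ, hτ⟩ => mem_biUnion hσ hτ

theorem exists_dual_ne_zero_of_not_disjoint (h : IsLocallyBalanceable 𝓢 d)
    (K : Submodule 𝕜 V) :
    ∃ ℓ : Dual 𝕜 V, ∀ σ ∈ 𝓢, ∀ τ : PointedCone 𝕜 V, τ.IsFaceOf σ →
      ¬ Disjoint K (Submodule.span 𝕜 (τ : Set V)) →
      ∃ u ∈ K ⊓ Submodule.span 𝕜 (τ : Set V), ℓ u ≠ 0 := by
  have hfin := h.finite_faces.sep fun τ : PointedCone 𝕜 V =>
    ¬ Disjoint K (Submodule.span 𝕜 (τ : Set V))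
  obtain ⟨ℓ, hℓ⟩ := exists_dual_forall_exists_mem_ne_zero hfin
    (W := fun τ => K ⊓ Submodule.span 𝕜 (τ : Set V)) fun τ hτ => disjoint_iff.not.1 hτ.2
  exact ⟨ℓ, fun σ hσ τ hτ hdisj => hℓ τ ⟨⟨σ, hσ, hτ⟩, hdisj⟩⟩

variable [FiniteDimensional 𝕜 V]

theorem exists_mem_forall_notMem_span_sup (h : IsLocallyBalanceable 𝓢 d) {σ₀ : PointedCone 𝕜 V}
    (hσ₀ : σ₀ ∈ 𝓢) (hatom : IsAtom (K ⊓ Submodule.span 𝕜 (σ₀ : Set V))) :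
    ∃ x ∈ σ₀, ∀ σ ∈ 𝓢, ∀ τ : PointedCone 𝕜 V, τ.IsFaceOf σ →
      finrank 𝕜 (Submodule.span 𝕜 (τ : Set V)) + 1 < d →
      x ∉ Submodule.span 𝕜 (τ : Set V) ⊔ K := by
  have hfin := h.finite_faces.sep fun τ : PointedCone 𝕜 V =>
    finrank 𝕜 (Submodule.span 𝕜 (τ : Set V)) + 1 < d
  have hne : ∀ τ ∈ {τ : PointedCone 𝕜 V | (∃ σ ∈ 𝓢, τ.IsFaceOf σ) ∧
      finrank 𝕜 (Submodule.span 𝕜 (τ : Set V)) + 1 < d},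
      ∃ x ∈ σ₀, x ∉ Submodule.span 𝕜 (τ : Set V) ⊔ K := by
    rintro τ ⟨-, hdim⟩
    by_contra! hle
    have hsup : K ⊔ Submodule.span 𝕜 (σ₀ : Set V) ≤ Submodule.span 𝕜 (τ : Set V) ⊔ K :=
      sup_le le_sup_right (Submodule.span_le.2 hle)
    have hmono := Submodule.finrank_mono hsup
    have hdim₀ := Submodule.finrank_sup_add_finrank_inf_eq K (Submodule.span 𝕜 (σ₀ : Set V))
    have hdimτ :=
      Submodule.finrank_add_le_finrank_add_finrank (Submodule.span 𝕜 (τ : Set V)) K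
    rw [Submodule.isAtom_iff_finrank_eq_one.1 hatom, h.finrank_span σ₀ hσ₀] at hdim₀
    omega
  obtain ⟨x, hx, hxW⟩ := exists_mem_forall_notMem hfin σ₀ _ hne
  exact ⟨x, hx, fun σ hσ τ hτ hdim => hxW τ ⟨⟨σ, hσ, hτ⟩, hdim⟩⟩

theorem exists_sub_mem_apply_lt (h : IsLocallyBalanceable 𝓢 d) {σ τ : PointedCone 𝕜 V} (hσ : σ ∈ 𝓢)
    (hτ : τ.IsFaceOf σ) (hdim : finrank 𝕜 (Submodule.span 𝕜 (τ : Set V)) + 1 = d)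
    (hdisj : Disjoint K (Submodule.span 𝕜 (τ : Set V)))
    (hK : ∀ ρ ∈ 𝓢, ¬ Disjoint K (Submodule.span 𝕜 (ρ : Set V))) {z : V}
    (hz : ∀ t ∈ Submodule.span 𝕜 (τ : Set V), ∃ ε : 𝕜, 0 < ε ∧ z + ε • t ∈ τ)
    {ℓ : Dual 𝕜 V} {u : V} (hu : u ∈ K ⊓ Submodule.span 𝕜 (σ : Set V)) (hℓu : ℓ u ≠ 0) :
    ∃ ρ ∈ 𝓢, ∃ y ∈ ρ, y - z ∈ K ∧ ℓ z < ℓ y := by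
  -- `g` extends `ℓ|K` by zero on `span τ`, so it detects the `K`-component of a vector of
  -- `span τ ⊔ K`, which contains every member through `τ`.
  obtain ⟨q, hτq, hq⟩ := hdisj.symm.exists_isCompl
  let g : Dual 𝕜 V := ℓ ∘ₗ K.projection q hq.symm
  have hgq : ∀ x ∈ q, g x = 0 := fun x hx => by
    simp [g, (Submodule.projection_apply_eq_zero_iff hq.symm).2 hx]
  have hgK : ∀ x ∈ K, g x = ℓ x := fun x hx => by
    simp [g, Submodule.projection_apply_of_mem_left hq.symm hx]
  have hgσ : ∃ x ∈ σ, g x ≠ 0 := by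
    by_contra! hσ0
    have hle : Submodule.span 𝕜 (σ : Set V) ≤ LinearMap.ker g := Submodule.span_le.2 hσ0
    exact hℓu (hgK u hu.1 ▸ hle hu.2)
  obtain ⟨ρ, hρ, hτρ, y, hy, hgy⟩ := h.exists_pos σ hσ τ hτ hdim g
    (fun x hx => hgq x (hτq (Submodule.subset_span hx))) hgσ
  have hspan := sup_inf_eq_of_finrank_add_one_eq (Submodule.span_mono hτρ)
    (hdim.trans (h.finrank_span ρ hρ).symm) hdisj (hK ρ hρ)
  obtain ⟨t, ht, k, hk, rfl⟩ := Submodule.mem_sup.1 (hspan.ge (Submodule.subset_span hy))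
  have hℓk : 0 < ℓ k := by rwa [map_add, hgq t (hτq ht), zero_add, hgK k hk.1] at hgy
  obtain ⟨ε, hε, hzt⟩ := hz (-t) (neg_mem ht)
  refine ⟨ρ, hρ, z + ε • k, ?_, by simpa using K.smul_mem ε hk.1, by simp [hε, hℓk]⟩
  convert ρ.add_mem (hτρ hzt) (ρ.smul_mem hε.le hy) using 1
  module

end Ridges

variable {E : Type*} [NormedAddCommGroup E] [NormedSpace ℝ E] [FiniteDimensional ℝ E]
  {𝓢 : Set (PointedCone ℝ E)} {d : ℕ} {K : Submodule ℝ E}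

theorem exists_mem_ne_zero_of_forall_not_disjoint_span (h : IsLocallyBalanceable 𝓢 d)
    (hK : ∀ σ ∈ 𝓢, ¬ Disjoint K (Submodule.span ℝ (σ : Set E))) :
    ∃ σ ∈ 𝓢, ∃ x ∈ σ, x ∈ K ∧ x ≠ 0 := by
  by_contra! htriv
  obtain ⟨K', hK'K, hK', σ₀, hσ₀, hatom⟩ := exists_le_forall_not_disjoint_isAtom h.nonempty
    (fun σ => Submodule.span ℝ (σ : Set E)) K hK
  obtain ⟨x, hxσ₀, hx⟩ := h.exists_mem_forall_notMem_span_sup hσ₀ hatom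
  obtain ⟨ℓ, hℓ⟩ := h.exists_dual_ne_zero_of_not_disjoint K'
  obtain ⟨σ, hσ, z, hzσ, hzx, hmax⟩ := exists_mem_sub_mem_forall_le h.finite
    (fun σ hσ => isClosed_of_fg (h.fg σ hσ)) (fun σ hσ x hx hxK => htriv σ hσ x hx (hK'K hxK))
    hσ₀ hxσ₀ ℓ
  let τ := σ ⊓ PointedCone.ofSubmodule (tangentLineality σ z)
  have hτσ : τ.IsFaceOf σ := isFaceOf_inf_tangentLineality hzσ
  have hzτ : z ∈ τ := ⟨hzσ, self_mem_tangentLineality hzσ⟩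
  have hτL := span_inf_tangentLineality_le σ z
  have hdisj : Disjoint K' (Submodule.span ℝ (τ : Set E)) := by
    by_contra hnot
    obtain ⟨u, hu, hℓu⟩ := hℓ σ hσ τ hτσ hnot
    exact hℓu (apply_eq_zero_of_mem_tangentLineality hzσ (hmax σ hσ) (hτL hu.2) hu.1)
  have hdim : finrank ℝ (Submodule.span ℝ (τ : Set E)) + 1 = d := by
    -- `x ∈ span τ ⊔ K'`, which the choice of `x` allows only in codimension at most one.
    have hge := mt (hx σ hσ τ hτσ) <| not_not.2 <| Submodule.mem_sup.2
      ⟨z, Submodule.subset_span hzτ, x - z, by simpa using neg_mem hzx, by simp⟩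
    have hspan : Submodule.span ℝ (τ : Set E) < Submodule.span ℝ (σ : Set E) :=
      (Submodule.span_mono hτσ.le).lt_of_ne fun heq => hK' σ hσ (heq ▸ hdisj)
    have hlt := Submodule.finrank_lt_finrank_of_lt hspan
    rw [h.finrank_span σ hσ] at hlt
    omega
  obtain ⟨u, hu, hℓu⟩ := hℓ σ hσ σ .rfl (hK' σ hσ)
  obtain ⟨ρ, hρ, y, hy, hyz, hlt⟩ := h.exists_sub_mem_apply_lt hσ hτσ hdim hdisj hK' (fun t ht => by
    obtain ⟨ε, hε, hmem⟩ := exists_pos_add_smul_mem hzσ (hτL ht)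
    exact ⟨ε, hε, hmem, add_mem hzτ.2 (Submodule.smul_mem _ ε (hτL ht))⟩) hu hℓu
  exact hlt.not_ge (hmax ρ hρ y hy hyz)

end IsLocallyBalanceable

section Products

theorem exists_add_one_eq_of_sum_add_one_eq {ι : Type*} [Fintype ι] {c d : ι → ℕ}
    (hcd : ∀ i, c i ≤ d i) (hsum : ∑ i, c i + 1 = ∑ i, d i) :
    ∃ j, c j + 1 = d j ∧ ∀ i ≠ j, c i = d i := by
  classical
  obtain ⟨j, -, hj⟩ := Finset.exists_lt_of_sum_lt (s := Finset.univ) (f := c) (g := d) (by omega)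
  have hle : ∀ i, c i + (Pi.single j 1 : ι → ℕ) i ≤ d i := fun i => by
    rcases eq_or_ne i j with rfl | hij
    · simpa using hj
    · simpa [hij] using hcd i
  have heq := (Finset.sum_eq_sum_iff_of_le (s := Finset.univ) fun i _ => hle i).1
    (by simpa [Finset.sum_add_distrib] using hsum)
  exact ⟨j, by simpa using heq j (Finset.mem_univ j),
    fun i hij => by simpa [hij] using heq i (Finset.mem_univ i)⟩

variable {ι : Type*} {V : ι → Type*} [∀ i, AddCommGroup (V i)]

theorem finrank_pi_univ [Fintype ι] {𝕜 : Type*} [DivisionRing 𝕜] [∀ i, Module 𝕜 (V i)]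
    [∀ i, FiniteDimensional 𝕜 (V i)] (p : ∀ i, Submodule 𝕜 (V i)) :
    finrank 𝕜 (Submodule.pi univ p) = ∑ i, finrank 𝕜 (p i) := by
  let f : (∀ i, p i) →ₗ[𝕜] ∀ i, V i := LinearMap.pi fun i => (p i).subtype ∘ₗ LinearMap.proj i
  have hf : Function.Injective f := fun x y hxy => funext fun i => Subtype.ext (congrFun hxy i)
  have hrange : LinearMap.range f = Submodule.pi univ p := by
    ext x
    exact ⟨by rintro ⟨y, rfl⟩ i -; exact (y i).2, fun hx => ⟨fun i => ⟨x i, hx i trivial⟩, rfl⟩⟩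
  rw [← hrange, LinearMap.finrank_range_of_inj hf, finrank_pi_fintype]

variable {𝕜 : Type*} [Field 𝕜] [LinearOrder 𝕜] [IsStrictOrderedRing 𝕜] [∀ i, Module 𝕜 (V i)]

theorem span_pi_univ [Finite ι] (σ : ∀ i, PointedCone 𝕜 (V i)) :
    Submodule.span 𝕜 (Submodule.pi univ σ : Set (∀ i, V i)) =
      Submodule.pi univ fun i => Submodule.span 𝕜 (σ i : Set (V i)) := by
  classical
  refine le_antisymm (Submodule.span_le.2 fun x hx i hi => Submodule.subset_span (hx i hi)) ?_
  rw [← Submodule.iSup_map_single]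
  refine iSup_le fun i => (Submodule.map_span_le _ _ _).2 fun x hx => Submodule.subset_span ?_
  exact Submodule.le_comap_single_pi σ hx

theorem comap_single_pi_univ [DecidableEq ι] (σ : ∀ i, PointedCone 𝕜 (V i)) (i : ι) :
    PointedCone.comap (LinearMap.single 𝕜 V i) (Submodule.pi univ σ) = σ i :=
  le_antisymm (fun x hx => by simpa using hx i (mem_univ i)) (Submodule.le_comap_single_pi σ)

theorem exists_eq_pi_of_isFaceOf_pi [Finite ι] {σ : ∀ i, PointedCone 𝕜 (V i)}
    {τ : PointedCone 𝕜 (∀ i, V i)} (hτ : τ.IsFaceOf (Submodule.pi univ σ)) :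
    ∃ τ' : ∀ i, PointedCone 𝕜 (V i), (∀ i, (τ' i).IsFaceOf (σ i)) ∧
      τ = Submodule.pi univ τ' := by
  classical
  cases nonempty_fintype ι
  refine ⟨fun i => PointedCone.comap (LinearMap.single 𝕜 V i) τ, fun i => ?_, ?_⟩
  · exact comap_single_pi_univ σ i ▸ hτ.comap (LinearMap.single 𝕜 V i)
  · ext x
    refine ⟨fun hx i _ => ?_, fun hx => ?_⟩
    · refine hτ.mem_of_sum_mem (f := fun i => Pi.single i (x i)) (fun i => ?_)
        (by rwa [Finset.univ_sum_single]) i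
      exact Submodule.le_comap_single_pi σ (hτ.le hx i (mem_univ i))
    · rw [← Finset.univ_sum_single x]
      exact Submodule.sum_mem _ fun i _ => hx i (mem_univ i)

theorem exists_eq_pi_of_isFaceOf_pi_of_finrank_add_one [Fintype ι]
    [∀ i, FiniteDimensional 𝕜 (V i)] {σ : ∀ i, PointedCone 𝕜 (V i)}
    {τ : PointedCone 𝕜 (∀ i, V i)} (hτ : τ.IsFaceOf (Submodule.pi univ σ))
    (hdim : finrank 𝕜 (Submodule.span 𝕜 (τ : Set (∀ i, V i))) + 1 =
      ∑ i, finrank 𝕜 (Submodule.span 𝕜 (σ i : Set (V i)))) :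
    ∃ τ' : ∀ i, PointedCone 𝕜 (V i), (∀ i, (τ' i).IsFaceOf (σ i)) ∧ τ = Submodule.pi univ τ' ∧
      ∃ j, finrank 𝕜 (Submodule.span 𝕜 (τ' j : Set (V j))) + 1 =
          finrank 𝕜 (Submodule.span 𝕜 (σ j : Set (V j))) ∧
        ∀ i ≠ j, Submodule.span 𝕜 (τ' i : Set (V i)) = Submodule.span 𝕜 (σ i : Set (V i)) := by
  obtain ⟨τ, hτσ, rfl⟩ := exists_eq_pi_of_isFaceOf_pi hτ
  have hle : ∀ i, Submodule.span 𝕜 (τ i : Set (V i)) ≤ Submodule.span 𝕜 (σ i : Set (V i)) :=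
    fun i => Submodule.span_mono (hτσ i).le
  rw [span_pi_univ, finrank_pi_univ] at hdim
  obtain ⟨j, hj, hne⟩ :=
    exists_add_one_eq_of_sum_add_one_eq (fun i => Submodule.finrank_mono (hle i)) hdim
  exact ⟨τ, hτσ, rfl, j, hj, fun i hi => Submodule.eq_of_le_of_finrank_eq (hle i) (hne i hi)⟩

theorem IsLocallyBalanceable.pi [Fintype ι] [∀ i, FiniteDimensional 𝕜 (V i)]
    {𝓢 : ∀ i, Set (PointedCone 𝕜 (V i))} {d : ι → ℕ}
    (h : ∀ i, IsLocallyBalanceable (𝓢 i) (d i)) :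
    IsLocallyBalanceable (Submodule.pi univ '' univ.pi 𝓢) (∑ i, d i) where
  finite := (Set.Finite.pi fun i => (h i).finite).image _
  nonempty := (univ_pi_nonempty_iff.2 fun i => (h i).nonempty).image _
  fg := by
    rintro _ ⟨σ, hσ, rfl⟩
    exact Submodule.fg_pi fun i => (h i).fg (σ i) (hσ i (mem_univ i))
  finrank_span := by
    rintro _ ⟨σ, hσ, rfl⟩
    rw [span_pi_univ, finrank_pi_univ]
    exact Finset.sum_congr rfl fun i _ => (h i).finrank_span (σ i) (hσ i (mem_univ i))
  exists_pos := by
    classical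
    rintro _ ⟨σ, hσ, rfl⟩ _ hτ hdim g hgτ ⟨x, hx, hgx⟩
    have hd : ∀ i, finrank 𝕜 (Submodule.span 𝕜 (σ i : Set (V i))) = d i :=
      fun i => (h i).finrank_span (σ i) (hσ i (mem_univ i))
    simp only [← hd] at hdim
    obtain ⟨τ, hτσ, rfl, j, hj, hspan⟩ := exists_eq_pi_of_isFaceOf_pi_of_finrank_add_one hτ hdim
    let g' : ∀ i, Dual 𝕜 (V i) := fun i => g ∘ₗ LinearMap.single 𝕜 V i
    have hg'τ : ∀ i, ∀ y ∈ τ i, g' i y = 0 := fun i y hy =>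
      hgτ _ (Submodule.le_comap_single_pi τ hy)
    have hg'x : ∀ i ≠ j, g' i (x i) = 0 := fun i hi => by
      have hker : Submodule.span 𝕜 (τ i : Set (V i)) ≤ LinearMap.ker (g' i) :=
        Submodule.span_le.2 (hg'τ i)
      exact hker (hspan i hi ▸ Submodule.subset_span (hx i (mem_univ i)))
    have hg'j : g' j (x j) ≠ 0 := by
      rw [← Finset.univ_sum_single x, map_sum] at hgx
      exact fun hzero => hgx ((Fintype.sum_eq_single j hg'x).trans hzero)
    obtain ⟨ρ, hρ, hτρ, y, hy, hpos⟩ := (h j).exists_pos (σ j) (hσ j (mem_univ j)) (τ j) (hτσ j)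
      (hj.trans (hd j)) (g' j) (hg'τ j) ⟨x j, hx j (mem_univ j), hg'j⟩
    have hτupdate : ∀ i, τ i ≤ Function.update σ j ρ i :=
      (Function.forall_update_iff σ fun i C => τ i ≤ C).2 ⟨hτρ, fun i _ => (hτσ i).le⟩
    refine ⟨_, ⟨Function.update σ j ρ, ?_, rfl⟩, Submodule.pi_mono fun i _ => hτupdate i,
      Pi.single j y, Submodule.le_comap_single_pi _ ?_, hpos⟩
    · exact (update_mem_pi_iff_of_mem hσ).2 fun _ => hρ
    · simpa using hy

end Products

section Codimension

variable {E : Type*} [NormedAddCommGroup E] [NormedSpace ℝ E] [FiniteDimensional ℝ E]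

theorem IsLocallyBalanceable.finrank_add_le {𝓢 : Set (PointedCone ℝ E)} {d : ℕ}
    (h : IsLocallyBalanceable 𝓢 d) {K : Submodule ℝ E} (hK : ∀ σ ∈ 𝓢, ∀ x ∈ σ, x ∈ K → x = 0) :
    finrank ℝ K + d ≤ finrank ℝ E := by
  obtain ⟨σ, hσ, hdisj⟩ : ∃ σ ∈ 𝓢, Disjoint K (Submodule.span ℝ (σ : Set E)) := by
    by_contra! hmeet
    obtain ⟨σ, hσ, x, hx, hxK, hx0⟩ := h.exists_mem_ne_zero_of_forall_not_disjoint_span hmeet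
    exact hx0 (hK σ hσ x hx hxK)
  rw [← h.finrank_span σ hσ]
  exact Submodule.finrank_add_finrank_le_of_disjoint hdisj

theorem mainTheorem6_general {ι : Type*} [Fintype ι] {𝓢 : ι → Set (PointedCone ℝ E)} {d : ι → ℕ}
    (h : ∀ i, IsLocallyBalanceable (𝓢 i) (d i)) :
    ∃ σ ∈ univ.pi 𝓢, (finrank ℝ E : ℤ) -
      finrank ℝ (Submodule.span ℝ ((⨅ i, σ i : PointedCone ℝ E) : Set E)) ≤
      ∑ i, ((finrank ℝ E : ℤ) - d i) := by
  obtain ⟨K, hK, σ, hσ, hcompl⟩ := exists_disjoint_isCompl (Set.Finite.pi fun i => (h i).finite)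
    (univ_pi_nonempty_iff.2 fun i => (h i).nonempty)
    fun σ : ι → PointedCone ℝ E => Submodule.span ℝ ((⨅ i, σ i : PointedCone ℝ E) : Set E)
  have hK0 : ∀ ρ ∈ univ.pi 𝓢, ∀ x ∈ K, (∀ i, x ∈ ρ i) → x = 0 := fun ρ hρ x hxK hx =>
    Submodule.disjoint_def.1 (hK ρ hρ) x hxK (Submodule.subset_span ((Submodule.mem_iInf _).2 hx))
  let diag : K →ₗ[ℝ] ι → E := LinearMap.pi fun _ => K.subtype
  have hinj : Function.Injective diag := (injective_iff_map_eq_zero diag).2 fun x hx => by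
    have hx0 : ∀ _ : ι, (x : E) = 0 := congrFun hx
    exact Subtype.ext (hK0 σ hσ x x.2 fun i => by rw [hx0 i]; exact zero_mem (σ i))
  have hle := (IsLocallyBalanceable.pi h).finrank_add_le (K := LinearMap.range diag) <| by
    rintro _ ⟨ρ, hρ, rfl⟩ _ hx ⟨x, rfl⟩
    rw [show x = 0 from Subtype.ext (hK0 ρ hρ x x.2 fun i => hx i (mem_univ i)), map_zero]
  rw [LinearMap.finrank_range_of_inj hinj, finrank_pi_fintype] at hle
  refine ⟨σ, hσ, ?_⟩
  have hdim := Submodule.finrank_add_eq_of_isCompl hcompl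
  zify at hle hdim
  rw [Finset.sum_sub_distrib]
  linarith

end Codimension

section Fans

variable {n : ℕ}

theorem latticePoint_sub_zsmul (u v : Fin n → ℤ) (m : ℤ) :
    latticePoint (u - m • v) = latticePoint u - (m : ℝ) • latticePoint v := by
  ext j
  simp [latticePoint]

theorem RealCone.IsRational.fg {C : RealCone n} (hC : C.IsRational) : C.FG := by
  obtain ⟨s, rfl⟩ := hC
  exact Submodule.fg_span (s.finite_toSet.image latticePoint)

theorem IsLatticeNormal.apply_ne_zero {τ σ : RealCone n} {v : Fin n → ℤ}
    (hv : IsLatticeNormal τ σ v) (hσ : σ.IsRational) {g : Dual ℝ (Fin n → ℝ)}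
    (hgτ : ∀ x ∈ τ, g x = 0) (hgσ : ∃ x ∈ σ, g x ≠ 0) : g (latticePoint v) ≠ 0 := by
  intro hgv
  obtain ⟨s, hs⟩ := hσ
  have hgspan : τ.linearSpan ≤ LinearMap.ker g := Submodule.span_le.2 hgτ
  have hσker : σ ≤ PointedCone.ofSubmodule (LinearMap.ker g) := by
    rw [hs]
    refine Submodule.span_le.2 ?_
    rintro _ ⟨u, hu, rfl⟩
    obtain ⟨m, hm⟩ := hv.2 u (Submodule.subset_span (hs ▸ PointedCone.subset_hull ⟨u, hu, rfl⟩))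
    rw [latticePoint_sub_zsmul] at hm
    simpa [hgv] using hgspan hm
  obtain ⟨x, hx, hgx⟩ := hgσ
  exact hgx (hσker hx)

theorem RealCone.dim_le_conesDim {S : Set (RealCone n)} {C : RealCone n} (hC : C ∈ S) :
    C.dim ≤ conesDim S :=
  le_csSup ⟨n, by rintro _ ⟨D, -, rfl⟩; exact D.dim_le⟩ (mem_image_of_mem _ hC)

namespace RationalFan

variable {F : RationalFan n} {w : RealCone n → ℝ} {σ : RealCone n}

theorem mem_facets : σ ∈ F.facets ↔ σ ∈ F.cones ∧ σ.dim = F.dim := by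
  simp [facets]

theorem facets_nonempty (F : RationalFan n) : F.facets.Nonempty := by
  obtain ⟨σ, hσ, hdim⟩ := Nat.sSup_mem (F.nonempty.to_set.image RealCone.dim)
    ⟨n, by rintro _ ⟨D, -, rfl⟩; exact D.dim_le⟩
  exact ⟨σ, mem_facets.2 ⟨hσ, hdim⟩⟩

theorem IsBalanced.isLocallyBalanceable (hF : F.IsBalanced w) (hw : ∀ σ ∈ F.facets, 0 < w σ) :
    IsLocallyBalanceable (F.facets : Set (RealCone n)) F.dim where
  finite := F.facets.finite_toSet
  nonempty := F.facets_nonempty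
  fg σ hσ := (F.isRational σ (mem_facets.1 hσ).1).fg
  finrank_span σ hσ := (mem_facets.1 hσ).2
  exists_pos := by
    classical
    intro σ hσ (τ : RealCone n) hτ hdim g hgτ hgσ
    obtain ⟨v, hv, hsum⟩ := hF τ (F.face_mem σ (mem_facets.1 hσ).1 τ hτ) hdim
    have hgspan : τ.linearSpan ≤ LinearMap.ker g := Submodule.span_le.2 hgτ
    have hgsum : ∑ ρ ∈ F.facets.filter (τ ≤ ·), w ρ * g (latticePoint (v ρ)) = 0 := by
      simpa using hgspan hsum
    have hgv := (hv σ hσ hτ.le).apply_ne_zero (F.isRational σ (mem_facets.1 hσ).1) hgτ hgσ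
    obtain ⟨ρ, hρ, hpos⟩ := Finset.exists_pos_of_sum_zero_of_exists_nonzero _ hgsum
      ⟨σ, Finset.mem_filter.2 ⟨hσ, hτ.le⟩, mul_ne_zero (hw σ hσ).ne' hgv⟩
    obtain ⟨hρF, hτρ⟩ := Finset.mem_filter.1 hρ
    exact ⟨ρ, hρF, hτρ, _, (hv ρ hρF hτρ).1, (pos_iff_pos_of_mul_pos hpos).1 (hw ρ hρF)⟩

end RationalFan

end Fans

theorem mainTheorem6 (n k : ℕ) (F : Fin k → RationalFan n) (w : Fin k → RealCone n → ℝ)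
    (hpos : ∀ i, ∀ σ ∈ (F i).facets, 0 < w i σ)
    (hbal : ∀ i, (F i).IsBalanced (w i)) :
    conesCodim (RationalFan.inter F) ≤ ∑ i, (F i).codim := by
  obtain ⟨σ, hσ, hle⟩ :=
    mainTheorem6_general fun i => (hbal i).isLocallyBalanceable (hpos i)
  rw [finrank_fin_fun] at hle
  have hmem : (⨅ i, σ i) ∈ RationalFan.inter F :=
    ⟨σ, fun i => (RationalFan.mem_facets.1 (hσ i (mem_univ i))).1, rfl⟩
  exact (sub_le_sub_left (mod_cast RealCone.dim_le_conesDim hmem) _).trans hle
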